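/- Let \((E, r)\) be a complete separable metric space, let \(x_0 \in E\), let \(k \colon \mathbb{R}_+ \to \mathbb{R}_+\) be a Borel function such that for every \(t > 0\) \[ \lim_{\varepsilon \searrow 0} \sup \big\{ k(s) \colon s \geq 0,\ s \neq t,\ t - \varepsilon \leq s \leq t + \varepsilon \big\} = 0, \] and let \(\kappa \colon \mathbb{R}_+ \to \mathbb{R}_+\) be continuous and non-decreasing. Let \(\mathbb{D}(E)\) be the space of càdlàg functions \(\mathbb{R}_+ \to E\) and set \[ G = \Big\{ \omega \in \mathbb{D}(E) \colon r(\omega(t), \omega(t-)) \leq k(t)\, \kappa\Big( \sup_{s \leq t} r(\omega(s), x_0) \Big) \text{ for all } t > 0 \Big\}. \] Then \(G\) is closed in \(\mathbb{D}(E)\) both for the local uniform topology (uniform convergence on compact subsets of \(\mathbb{R}_+\)) and for the Skorokhod \(J_1\) topology. Moreover, on \(G\) the Skorokhod \(J_1\) topology coincides with the local uniform topology, i.e. both induce the same subspace topology on \(G\). -/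

import Mathlib

open Set Filter Topology TopologicalSpace
open scoped NNReal ENNReal Uniformity

/-- The space `D(E)` of càdlàg paths `[0, ∞) → E`: right-continuous with left limits. -/
structure CadlagPath (E : Type*) [TopologicalSpace E] where
  /-- The underlying function. -/
  toFun : ℝ≥0 → E
  right_cont : ∀ t : ℝ≥0, Tendsto toFun (𝓝[>] t) (𝓝 (toFun t))
  left_lim : ∀ t : ℝ≥0, 0 < t → ∃ l : E, Tendsto toFun (𝓝[<] t) (𝓝 l)

namespace CadlagPath

instance {E : Type*} [TopologicalSpace E] : CoeFun (CadlagPath E) (fun _ => ℝ≥0 → E) :=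
  ⟨CadlagPath.toFun⟩

/-- The local uniform topology on `D(E)`: uniform convergence on compact subsets of `[0, ∞)`. -/
@[reducible]
def localUniformTopology (E : Type*) [MetricSpace E] : TopologicalSpace (CadlagPath E) :=
  TopologicalSpace.induced
    (fun ω : CadlagPath E => UniformOnFun.ofFun {K : Set ℝ≥0 | IsCompact K} ω.toFun) inferInstance

/-- The basic Skorokhod `J₁` entourages. The pair `(α, β)` is in the entourage of `T` and `ε` if
for some time change `τ` (an increasing bijection of `[0, ∞)`) one has `|τ(s) - s| < ε` for all `s`
and `r(α(s), β(τ(s))) < ε` for all `s ≤ T`. -/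
def skorokhodEntourage (E : Type*) [MetricSpace E] (T : ℝ≥0) (ε : ℝ) :
    Set (CadlagPath E × CadlagPath E) :=
  {p | ∃ τ : ℝ≥0 ≃o ℝ≥0,
    (∀ s : ℝ≥0, dist (τ s) s < ε) ∧ ∀ s : ℝ≥0, s ≤ T → dist (p.1 s) (p.2 (τ s)) < ε}

theorem skorokhodEntourage_mono (E : Type*) [MetricSpace E] {T T' : ℝ≥0} {ε ε' : ℝ}
    (hT : T' ≤ T) (hε : ε ≤ ε') : skorokhodEntourage E T ε ⊆ skorokhodEntourage E T' ε' := by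
  rintro p ⟨τ, h1, h2⟩
  exact ⟨τ, fun s => (h1 s).trans_le hε, fun s hs => (h2 s (hs.trans hT)).trans_le hε⟩

/-- The basic entourages form a filter basis. -/
def skorokhodBasis (E : Type*) [MetricSpace E] : FilterBasis (CadlagPath E × CadlagPath E) where
  sets := {V | ∃ (T : ℝ≥0) (ε : ℝ), 0 < ε ∧ V = skorokhodEntourage E T ε}
  nonempty := ⟨_, 0, 1, one_pos, rfl⟩
  inter_sets := by
    rintro _ _ ⟨T, ε, hε, rfl⟩ ⟨T', ε', hε', rfl⟩
    refine ⟨_, ⟨max T T', min ε ε', lt_min hε hε', rfl⟩, subset_inter ?_ ?_⟩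
    · exact skorokhodEntourage_mono E (le_max_left _ _) (min_le_left _ _)
    · exact skorokhodEntourage_mono E (le_max_right _ _) (min_le_right _ _)

/-- The uniform structure on `D(E)` generated by the basic Skorokhod `J₁` entourages. -/
def skorokhodUniformity (E : Type*) [MetricSpace E] : UniformSpace.Core (CadlagPath E) :=
  UniformSpace.Core.mkOfBasis (skorokhodBasis E)
    (by
      rintro _ ⟨T, ε, hε, rfl⟩ ω
      exact ⟨OrderIso.refl _, fun s => by simpa using hε, fun s _ => by simpa using hε⟩)
    (by
      rintro _ ⟨T, ε, hε, rfl⟩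
      refine ⟨_, ⟨T + ε.toNNReal, ε, hε, rfl⟩, ?_⟩
      rintro ⟨α, β⟩ ⟨τ, h1, h2⟩
      have h3 : ∀ s, dist (τ.symm s) s < ε := fun s => by
        have := h1 (τ.symm s)
        rwa [τ.apply_symm_apply, dist_comm] at this
      refine ⟨τ.symm, h3, fun s hs => ?_⟩
      have h4 : τ.symm s ≤ T + ε.toNNReal := by
        have h5 := h3 s
        rw [NNReal.dist_eq, abs_lt] at h5
        have h6 : (s : ℝ) ≤ T := hs
        have : (τ.symm s : ℝ) ≤ T + (ε.toNNReal : ℝ) := by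
          rw [Real.coe_toNNReal _ hε.le]; linarith [h5.2]
        exact_mod_cast this
      have h7 := h2 _ h4
      rwa [τ.apply_symm_apply, dist_comm] at h7)
    (by
      rintro _ ⟨T, ε, hε, rfl⟩
      refine ⟨_, ⟨T + ε.toNNReal, ε / 2, half_pos hε, rfl⟩, ?_⟩
      rintro ⟨α, γ⟩ ⟨β, ⟨τ, h1, h2⟩, ⟨σ, h3, h4⟩⟩
      refine ⟨τ.trans σ, fun s => ?_, fun s hs => ?_⟩
      · calc dist (σ (τ s)) s ≤ dist (σ (τ s)) (τ s) + dist (τ s) s := dist_triangle _ _ _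
          _ < ε := by linarith [h1 s, h3 (τ s)]
      · have h6 : (s : ℝ) ≤ T := hs
        have h4' : τ s ≤ T + ε.toNNReal := by
          have h5 := h1 s
          rw [NNReal.dist_eq, abs_lt] at h5
          have : (τ s : ℝ) ≤ T + (ε.toNNReal : ℝ) := by
            rw [Real.coe_toNNReal _ hε.le]; linarith [h5.2]
          exact_mod_cast this
        calc dist (α s) (γ (σ (τ s))) ≤ dist (α s) (β (τ s)) + dist (β (τ s)) (γ (σ (τ s))) :=
              dist_triangle _ _ _
          _ < ε := by linarith [h2 s (hs.trans le_self_add), h4 _ h4'])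

/-- The Skorokhod `J₁` topology on `D(E)`. The sets of all `β` with `(ω, β)` in the entourage of
`T` and `ε` are a neighbourhood basis at `ω`, so that `ωₙ → ω` if and only if there are time
changes `τₙ` with `sup_s |τₙ(s) - s| → 0` and `sup_{s ≤ T} r(ωₙ(τₙ(s)), ω(s)) → 0` for all `T`. -/
@[reducible]
def skorokhodJ1Topology (E : Type*) [MetricSpace E] : TopologicalSpace (CadlagPath E) :=
  (UniformSpace.ofCore (skorokhodUniformity E)).toTopologicalSpace

/-- A càdlàg path is bounded on each `[0, t]`, so the supremum in `jumpControlledPaths` is the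
actual least upper bound. -/
theorem bddAbove_nndist {E : Type*} [MetricSpace E] (ω : CadlagPath E) (x₀ : E) (t : ℝ≥0) :
    BddAbove (range fun s : Iic t => nndist (ω s) x₀) := by
  suffices h : BddAbove ((fun s => nndist (ω s) x₀) '' Icc 0 t) by
    refine h.mono ?_
    rintro _ ⟨s, rfl⟩
    exact ⟨s, ⟨zero_le, s.2⟩, rfl⟩
  have key : ∀ (F : Filter ℝ≥0) (l : E), Tendsto ω.toFun F (𝓝 l) →
      ∃ u ∈ F, BddAbove ((fun s => nndist (ω s) x₀) '' u) := by
    intro F l h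
    have h' : Tendsto (fun s => nndist (ω s) x₀) F (𝓝 (nndist l x₀)) := h.nndist tendsto_const_nhds
    refine ⟨_, h'.eventually (ge_mem_nhds (lt_add_one _)), nndist l x₀ + 1, ?_⟩
    rintro _ ⟨s, hs, rfl⟩
    exact hs
  refine isCompact_Icc.induction_on (p := fun u => BddAbove ((fun s => nndist (ω s) x₀) '' u))
    (by simp) (fun u v huv hv => hv.mono (image_mono huv))
    (fun u v hu hv => by rw [image_union]; exact hu.union hv) (fun s _ => ?_)
  obtain ⟨u, hu, hub⟩ := key _ _ (ω.right_cont s)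
  obtain ⟨v, hv, hvb⟩ : ∃ v ∈ 𝓝[<] s, BddAbove ((fun s => nndist (ω s) x₀) '' v) := by
    rcases eq_or_ne s 0 with rfl | hs
    · exact ⟨∅, by simp, by simp⟩
    · obtain ⟨l, hl⟩ := ω.left_lim s (pos_iff_ne_zero.2 hs)
      exact key _ _ hl
  refine ⟨v ∪ u ∪ {s}, mem_nhdsWithin_of_mem_nhds ?_, ?_⟩
  · have : 𝓝 s = 𝓝[<] s ⊔ 𝓝[>] s ⊔ pure s := by
      rw [← nhdsNE_sup_pure, ← nhdsLT_sup_nhdsGT]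
    rw [this]
    exact union_mem_sup (union_mem_sup hv hu) (by simp)
  · rw [image_union, image_union]
    exact (hvb.union hub).union (by simp)

/-- The set `G` of all `ω` in `D(E)` such that
`r(ω(t), ω(t-)) ≤ k(t) * κ(sup_{s ≤ t} r(ω(s), x₀))` for all `t > 0`. -/
def jumpControlledPaths {E : Type*} [MetricSpace E] (k κ : ℝ≥0 → ℝ≥0) (x₀ : E) :
    Set (CadlagPath E) :=
  {ω | ∀ t : ℝ≥0, 0 < t →
    nndist (ω t) (Function.leftLim ω.toFun t) ≤ k t * κ (⨆ s : Iic t, nndist (ω s) x₀)}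

end CadlagPath

/-!
The point is that a Skorokhod approximation `α ∈ G` of `ω` cannot move the jumps of `ω`. Suppose
`ω` jumps at `t > 0` and `α ∘ τ` is `δ`-close to `ω` on `[0, t]`. Then `α` jumps at `τ t`, by an
amount at least `r(ω(t), ω(t-)) - 2δ`, while membership in `G` bounds this jump by
`k (τ t) * κ (sup_{s ≤ t} r(ω(s), x₀) + δ)` (`CadlagPath.nndist_leftLim_le_of_timeChange`). The
second factor stays bounded and `k (τ t)` is small if `τ t` is close to, but different from, `t`.
Hence `τ t = t` as soon as `α` is close enough to `ω` (`CadlagPath.exists_forall_timeChange_eq`).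

Closedness in `J₁` follows: at a jump time `t` of a limit `ω` of elements of `G`, the estimate above
holds with `τ t = t` and arbitrarily small `δ`, and `κ` is continuous. Since the local uniform
topology is finer than `J₁` (take `τ = id`), `G` is also closed for the former.

For the coincidence of the topologies, fix `t`. Near `t` the path `ω` is nearly constant on each
side of `t`, and on both sides at once if it does not jump at `t`. If it does jump there, `τ` fixes
`t`, so that `s` and `τ⁻¹ s` lie on the same side. Either way `ω (τ⁻¹ s)` is close to `ω s`, so `α s`
is close to `ω s` for all `s` near `t` (`CadlagPath.eventually_dist_lt_of_skorokhod`), and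
compactness makes this uniform on compact sets.
-/

namespace CadlagPath

variable {E : Type*} [MetricSpace E]

/-! ### Neighbourhoods in the two topologies -/

theorem hasBasis_nhds_skorokhodJ1 (ω : CadlagPath E) :
    (@nhds _ (skorokhodJ1Topology E) ω).HasBasis (fun p : ℝ≥0 × ℝ => 0 < p.2)
      (fun p => {α | (ω, α) ∈ skorokhodEntourage E p.1 p.2}) := by
  let : UniformSpace (CadlagPath E) := UniformSpace.ofCore (skorokhodUniformity E)
  have h : (𝓤 (CadlagPath E)).HasBasis (fun p : ℝ≥0 × ℝ => 0 < p.2)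
      (fun p => skorokhodEntourage E p.1 p.2) := by
    refine ⟨fun V => ?_⟩
    change V ∈ (skorokhodBasis E).filter ↔ _
    rw [FilterBasis.mem_filter_iff]
    constructor
    · rintro ⟨_, ⟨T, ε, hε, rfl⟩, hV⟩
      exact ⟨(T, ε), hε, hV⟩
    · rintro ⟨⟨T, ε⟩, hε, hV⟩
      exact ⟨_, ⟨T, ε, hε, rfl⟩, hV⟩
  exact nhds_basis_uniformity' h

theorem tendsto_localUniform_iff {ι : Type*} {F : Filter ι} {u : ι → CadlagPath E}
    {ω : CadlagPath E} :
    Tendsto u F (@nhds _ (localUniformTopology E) ω) ↔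
      ∀ K : Set ℝ≥0, IsCompact K → TendstoUniformlyOn (fun i => (u i).toFun) ω.toFun F K := by
  rw [nhds_induced, tendsto_comap_iff, UniformOnFun.tendsto_iff_tendstoUniformlyOn]
  rfl

theorem localUniformTopology_le_skorokhodJ1Topology :
    localUniformTopology E ≤ skorokhodJ1Topology E := by
  refine le_of_nhds_le_nhds fun ω => (hasBasis_nhds_skorokhodJ1 ω).ge_iff.2 ?_
  rintro ⟨T, ε⟩ hε
  have h := tendsto_localUniform_iff.1 (tendsto_id (x := @nhds _ (localUniformTopology E) ω))
    (Icc 0 T) isCompact_Icc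
  filter_upwards [Metric.tendstoUniformlyOn_iff.1 h ε hε] with α hα
  exact ⟨OrderIso.refl _, fun s => by simpa using hε, fun s hs => hα s ⟨zero_le, hs⟩⟩

/-! ### Jumps under time changes -/

theorem tendsto_leftLim (ω : CadlagPath E) {t : ℝ≥0} (ht : 0 < t) :
    Tendsto ω.toFun (𝓝[<] t) (𝓝 (Function.leftLim ω.toFun t)) := by
  obtain ⟨l, hl⟩ := ω.left_lim t ht
  have : (𝓝[<] t).NeBot := nhdsLT_neBot_of_exists_lt ⟨0, ht⟩
  rwa [leftLim_eq_of_tendsto hl]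

theorem continuousAt_of_leftLim_eq (ω : CadlagPath E) {t : ℝ≥0}
    (h : 0 < t → Function.leftLim ω.toFun t = ω t) : ContinuousAt ω.toFun t := by
  refine continuousAt_iff_continuous_left'_right'.2 ⟨?_, ω.right_cont t⟩
  rcases eq_zero_or_pos t with rfl | ht
  · simp [ContinuousWithinAt]
  · have := ω.tendsto_leftLim ht
    rwa [h ht] at this

/-- If `α ∘ τ` is `δ`-close to `ω` on `[0, t]`, the jump of `ω` at `t` exceeds that of `α` at `τ t`
by at most `2δ`, and the running suprema differ by at most `δ`. Hence the bound on the jumps of `α`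
carries over to `ω`, with `k` evaluated at `τ t`. -/
theorem nndist_leftLim_le_of_timeChange {k κ : ℝ≥0 → ℝ≥0} {x₀ : E} (hκ : Monotone κ)
    {ω α : CadlagPath E} (hα : α ∈ jumpControlledPaths k κ x₀) {t δ : ℝ≥0} (ht : 0 < t)
    (τ : ℝ≥0 ≃o ℝ≥0) (hτ : ∀ s ≤ t, nndist (ω s) (α (τ s)) ≤ δ) :
    nndist (ω t) (Function.leftLim ω.toFun t) ≤
      2 * δ + k (τ t) * κ ((⨆ s : Iic t, nndist (ω s) x₀) + δ) := by
  have hτt : 0 < τ t := zero_le.trans_lt (τ.lt_iff_lt.2 ht)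
  have : (𝓝[<] t).NeBot := nhdsLT_neBot_of_exists_lt ⟨0, ht⟩
  have hlim : nndist (Function.leftLim ω.toFun t) (Function.leftLim α.toFun (τ t)) ≤ δ := by
    have h1 : Tendsto τ (𝓝[<] t) (𝓝[<] (τ t)) :=
      tendsto_nhdsWithin_iff.2 ⟨τ.continuous.continuousAt.tendsto.mono_left nhdsWithin_le_nhds,
        eventually_mem_nhdsWithin.mono fun s hs => τ.lt_iff_lt.2 hs⟩
    refine le_of_tendsto ((ω.tendsto_leftLim ht).nndist ((α.tendsto_leftLim hτt).comp h1)) ?_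
    exact eventually_mem_nhdsWithin.mono fun s hs => hτ s (le_of_lt hs)
  have hsup : (⨆ s : Iic (τ t), nndist (α s) x₀) ≤ (⨆ s : Iic t, nndist (ω s) x₀) + δ := by
    refine ciSup_le' ?_
    rintro ⟨u, hu⟩
    have hs : τ.symm u ≤ t := τ.symm_apply_le.2 hu
    have h1 := hτ _ hs
    rw [τ.apply_symm_apply, nndist_comm] at h1
    have h2 := le_ciSup (bddAbove_nndist ω x₀ t) ⟨τ.symm u, hs⟩
    calc nndist (α u) x₀ ≤ nndist (α u) (ω (τ.symm u)) + nndist (ω (τ.symm u)) x₀ :=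
          nndist_triangle _ _ _
      _ ≤ δ + _ := add_le_add h1 h2
      _ = _ := add_comm _ _
  have hjump := hα (τ t) hτt
  calc nndist (ω t) (Function.leftLim ω.toFun t)
      ≤ nndist (ω t) (α (τ t)) + nndist (α (τ t)) (Function.leftLim α.toFun (τ t))
        + nndist (Function.leftLim α.toFun (τ t)) (Function.leftLim ω.toFun t) :=
          (nndist_triangle _ (Function.leftLim α.toFun (τ t)) _).trans
            (add_le_add_left (nndist_triangle _ _ _) _)
    _ ≤ δ + k (τ t) * κ ((⨆ s : Iic t, nndist (ω s) x₀) + δ) + δ := by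
        refine add_le_add (add_le_add (hτ t le_rfl) (hjump.trans ?_)) (by rwa [nndist_comm])
        exact mul_le_mul_right (hκ hsup) _
    _ = _ := by ring

/-- Rigidity of jump times: time changes that match `ω` closely with a path of
`jumpControlledPaths k κ x₀` fix the jump times of `ω`. -/
theorem exists_forall_timeChange_eq {k κ : ℝ≥0 → ℝ≥0} {x₀ : E} {t : ℝ≥0}
    (hk : Tendsto
        (fun ε : ℝ => ⨆ s ∈ {s : ℝ≥0 | s ≠ t ∧ (t : ℝ) - ε ≤ s ∧ (s : ℝ) ≤ t + ε}, (k s : ℝ≥0∞))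
        (𝓝[>] 0) (𝓝 0))
    (hκ : Monotone κ) (ω : CadlagPath E) (ht : 0 < t) (hω : Function.leftLim ω.toFun t ≠ ω t) :
    ∃ δ : ℝ, 0 < δ ∧ ∀ α ∈ jumpControlledPaths k κ x₀, ∀ τ : ℝ≥0 ≃o ℝ≥0,
      (∀ s, dist (τ s) s < δ) → (∀ s ≤ t, dist (ω s) (α (τ s)) < δ) → τ t = t := by
  set D := nndist (ω t) (Function.leftLim ω.toFun t)
  have hD0 : 0 < D := pos_iff_ne_zero.2 fun h => hω (nndist_eq_zero.1 h).symm
  set M := ⨆ s : Iic t, nndist (ω s) x₀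
  -- The summand `1` only keeps the denominator positive.
  set c : ℝ≥0 := D / 4 / (κ (M + 1) + 1)
  have hc0 : 0 < c := by positivity
  have h1 := hk.eventually (gt_mem_nhds (ENNReal.coe_pos.2 hc0))
  have h2 : Ioo (0 : ℝ) (min 1 (D / 4)) ∈ 𝓝[>] (0 : ℝ) :=
    Ioo_mem_nhdsGT (lt_min one_pos (by positivity))
  obtain ⟨δ, hδ, hδ0, hδ1⟩ := (h1.and h2).exists
  refine ⟨δ, hδ0, fun α hα τ hτ hατ => ?_⟩
  by_contra hne
  lift δ to ℝ≥0 using hδ0.le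
  have hδ1' : δ ≤ 1 := by exact_mod_cast (hδ1.trans_le (min_le_left _ _)).le
  have hkc : k (τ t) ≤ c := by
    have h3 := hτ t
    rw [NNReal.dist_eq, abs_lt] at h3
    have h4 : τ t ∈ {s : ℝ≥0 | s ≠ t ∧ (t : ℝ) - δ ≤ s ∧ (s : ℝ) ≤ t + δ} :=
      ⟨hne, by linarith [h3.1], by linarith [h3.2]⟩
    exact ENNReal.coe_le_coe.1
      ((le_iSup₂ (f := fun s _ => (k s : ℝ≥0∞)) (τ t) h4).trans hδ.le)
  have h5 := nndist_leftLim_le_of_timeChange hκ hα ht τ (δ := δ) fun s hs => by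
    exact_mod_cast (hατ s hs).le
  have h6 : k (τ t) * κ (M + δ) ≤ D / 4 :=
    calc k (τ t) * κ (M + δ) ≤ c * (κ (M + 1) + 1) :=
          mul_le_mul' hkc ((hκ (add_le_add_right hδ1' M)).trans le_self_add)
      _ = D / 4 := div_mul_cancel₀ _ (by positivity)
  have h7 : D ≤ 2 * δ + D / 4 := h5.trans (add_le_add_right h6 _)
  have h8 : (D : ℝ) ≤ 2 * δ + D / 4 := by exact_mod_cast h7
  have h9 : (δ : ℝ) < D / 4 := hδ1.trans_le (min_le_right _ _)
  have h10 : (0 : ℝ) < D := by exact_mod_cast hD0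
  linarith

/-! ### Closedness and comparison of the topologies -/

section

variable {k κ : ℝ≥0 → ℝ≥0} {x₀ : E}
  (hk : ∀ t : ℝ≥0, 0 < t →
    Tendsto
      (fun ε : ℝ => ⨆ s ∈ {s : ℝ≥0 | s ≠ t ∧ (t : ℝ) - ε ≤ s ∧ (s : ℝ) ≤ t + ε}, (k s : ℝ≥0∞))
      (𝓝[>] 0) (𝓝 0))
  (hκ_mono : Monotone κ)

include hk hκ_mono

theorem isClosed_skorokhodJ1_jumpControlledPaths (hκ_cont : Continuous κ) :
    IsClosed[skorokhodJ1Topology E] (jumpControlledPaths k κ x₀) := by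
  let := skorokhodJ1Topology E
  refine isClosed_of_closure_subset fun ω hω t ht => ?_
  rw [mem_closure_iff_nhds_basis (hasBasis_nhds_skorokhodJ1 ω)] at hω
  by_cases hj : Function.leftLim ω.toFun t = ω t
  · simp [hj]
  obtain ⟨δ₀, hδ₀, hfix⟩ := exists_forall_timeChange_eq (x₀ := x₀) (hk t ht) hκ_mono ω ht hj
  have hlim : Tendsto
      (fun δ : ℝ≥0 => 2 * δ + k t * κ ((⨆ s : Iic t, nndist (ω s) x₀) + δ)) (𝓝[>] 0)
      (𝓝 (k t * κ (⨆ s : Iic t, nndist (ω s) x₀))) := by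
    have hc : Continuous
        (fun δ : ℝ≥0 => 2 * δ + k t * κ ((⨆ s : Iic t, nndist (ω s) x₀) + δ)) := by fun_prop
    simpa using (hc.tendsto 0).mono_left nhdsWithin_le_nhds
  refine ge_of_tendsto hlim ?_
  filter_upwards [self_mem_nhdsWithin] with δ hδ
  have hδ' : (0 : ℝ) < δ := by exact_mod_cast hδ
  obtain ⟨α, hα, τ, h1, h2⟩ := hω (t, min δ₀ δ) (lt_min hδ₀ hδ')
  have hτt := hfix α hα τ (fun s => (h1 s).trans_le (min_le_left _ _))
    fun s hs => (h2 s hs).trans_le (min_le_left _ _)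
  have h3 := nndist_leftLim_le_of_timeChange hκ_mono hα ht τ (δ := δ) fun s hs => by
    exact_mod_cast ((h2 s hs).trans_le (min_le_right _ _)).le
  rwa [hτt] at h3

/-- A time change that matches `ω` closely with a jump controlled path moves the values of `ω` near
`t` only a little: if `ω` jumps at `t`, then `t` is a fixed point of the time change, so that no
point is moved across the jump. -/
theorem exists_dist_timeChange_lt (ω : CadlagPath E) (t : ℝ≥0) {ε : ℝ} (hε : 0 < ε) :
    ∃ δ : ℝ, 0 < δ ∧ ∀ α ∈ jumpControlledPaths k κ x₀, ∀ τ : ℝ≥0 ≃o ℝ≥0,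
      (∀ s, dist (τ s) s < δ) → (∀ s ≤ t, dist (ω s) (α (τ s)) < δ) →
      ∀ s, dist s t < δ → dist (τ s) t < δ → dist (ω (τ s)) (ω s) < ε := by
  have near : ∀ {l x y : E}, dist x l < ε / 2 → dist y l < ε / 2 → dist x y < ε :=
    fun hx hy => (dist_triangle_right _ _ _).trans_lt (by linarith)
  by_cases hj : 0 < t → Function.leftLim ω.toFun t = ω t
  · obtain ⟨η, hη, hη'⟩ := Metric.continuousAt_iff.1 (ω.continuousAt_of_leftLim_eq hj) (ε / 2)
      (half_pos hε)
    exact ⟨η, hη, fun α _ τ _ _ s hs hs' => near (hη' hs') (hη' hs)⟩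
  · push Not at hj
    obtain ⟨ht, hj⟩ := hj
    obtain ⟨δ₀, hδ₀, hfix⟩ := exists_forall_timeChange_eq (x₀ := x₀) (hk t ht) hκ_mono ω ht hj
    obtain ⟨η₁, hη₁, hleft⟩ := Metric.tendsto_nhdsWithin_nhds.1 (ω.tendsto_leftLim ht) (ε / 2)
      (half_pos hε)
    have hr : ContinuousWithinAt ω.toFun (Ici t) t :=
      continuousWithinAt_Ioi_iff_Ici.1 (ω.right_cont t)
    obtain ⟨η₂, hη₂, hright⟩ := Metric.tendsto_nhdsWithin_nhds.1 hr (ε / 2) (half_pos hε)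
    refine ⟨min δ₀ (min η₁ η₂), lt_min hδ₀ (lt_min hη₁ hη₂), fun α hα τ h1 h2 s hs hs' => ?_⟩
    simp only [lt_min_iff] at h1 h2 hs hs'
    have hτt := hfix α hα τ (fun s => (h1 s).1) fun s hs => (h2 s hs).1
    rcases lt_or_ge s t with hst | hst
    · have hst' : τ s < t := by rwa [← hτt, τ.lt_iff_lt]
      exact near (hleft hst' hs'.2.1) (hleft hst hs.2.1)
    · have hst' : t ≤ τ s := by rwa [← hτt, τ.le_iff_le]
      exact near (hright hst' hs'.2.2) (hright hst hs.2.2)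

theorem eventually_dist_lt_of_skorokhod (ω : CadlagPath E) (t : ℝ≥0) {ε : ℝ} (hε : 0 < ε) :
    ∃ U ∈ 𝓝 t, ∀ᶠ α in @nhds _ (skorokhodJ1Topology E) ω, α ∈ jumpControlledPaths k κ x₀ →
      ∀ s ∈ U, dist (ω s) (α s) < ε := by
  obtain ⟨δ, hδ, h⟩ := exists_dist_timeChange_lt (x₀ := x₀) hk hκ_mono ω t (half_pos hε)
  refine ⟨Metric.ball t (δ / 2), Metric.ball_mem_nhds _ (half_pos hδ), ?_⟩
  -- The horizon is `t + δ`, since a point near `t` may have its `τ`-preimage beyond `t`.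
  have hρ : 0 < min (δ / 2) (ε / 2) := lt_min (half_pos hδ) (half_pos hε)
  refine (hasBasis_nhds_skorokhodJ1 ω).mem_iff.2 ⟨(t + δ.toNNReal, min (δ / 2) (ε / 2)), hρ, ?_⟩
  rintro α ⟨τ, h1, h2⟩ hα s hs
  simp only [lt_min_iff] at h1 h2
  obtain ⟨u, rfl⟩ := τ.surjective s
  rw [Metric.mem_ball] at hs
  have hu : dist u t < δ := by
    have h3 := (h1 u).1
    rw [dist_comm] at h3
    linarith [dist_triangle u (τ u) t]
  have huT : u ≤ t + δ.toNNReal := by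
    rw [NNReal.dist_eq, abs_lt] at hu
    rw [← NNReal.coe_le_coe, NNReal.coe_add, Real.coe_toNNReal _ hδ.le]
    linarith [hu.2]
  have h3 := h α hα τ (fun s => (h1 s).1.trans (half_lt_self hδ))
    (fun s hs => (h2 s (hs.trans le_self_add)).1.trans (half_lt_self hδ)) u hu (by linarith)
  calc dist (ω (τ u)) (α (τ u)) ≤ dist (ω (τ u)) (ω u) + dist (ω u) (α (τ u)) :=
        dist_triangle _ _ _
    _ < ε := by linarith [(h2 u huT).2]

theorem induced_skorokhodJ1_le_induced_localUniform :
    TopologicalSpace.induced (Subtype.val : jumpControlledPaths k κ x₀ → CadlagPath E)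
        (skorokhodJ1Topology E) ≤
      TopologicalSpace.induced (Subtype.val : jumpControlledPaths k κ x₀ → CadlagPath E)
        (localUniformTopology E) := by
  refine le_of_nhds_le_nhds fun ω => ?_
  rw [@nhds_induced _ _ (skorokhodJ1Topology E), @nhds_induced _ _ (localUniformTopology E),
    ← tendsto_iff_comap, tendsto_localUniform_iff]
  intro K hK
  rw [← tendstoLocallyUniformlyOn_iff_tendstoUniformlyOn_of_compact hK,
    Metric.tendstoLocallyUniformlyOn_iff]
  intro ε hε t _
  obtain ⟨U, hU, h⟩ :=
    eventually_dist_lt_of_skorokhod (x₀ := x₀) hk hκ_mono ω.1 t hε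
  refine ⟨U, mem_nhdsWithin_of_mem_nhds hU, ?_⟩
  filter_upwards [tendsto_comap.eventually h] with α hα
  exact hα α.2

end

end CadlagPath

theorem proposition2p20 {E : Type*} [MetricSpace E] [CompleteSpace E] [SeparableSpace E]
    (k : ℝ≥0 → ℝ≥0) (hk_meas : Measurable k)
    (hk : ∀ t : ℝ≥0, 0 < t →
      Tendsto
        (fun ε : ℝ => ⨆ s ∈ {s : ℝ≥0 | s ≠ t ∧ (t : ℝ) - ε ≤ s ∧ (s : ℝ) ≤ t + ε}, (k s : ℝ≥0∞))
        (𝓝[>] 0) (𝓝 0))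
    (κ : ℝ≥0 → ℝ≥0) (hκ_mono : Monotone κ) (hκ_cont : Continuous κ) (x₀ : E) :
    IsClosed[CadlagPath.localUniformTopology E] (CadlagPath.jumpControlledPaths k κ x₀) ∧
    IsClosed[CadlagPath.skorokhodJ1Topology E] (CadlagPath.jumpControlledPaths k κ x₀) ∧
    TopologicalSpace.induced
        (Subtype.val : CadlagPath.jumpControlledPaths k κ x₀ → CadlagPath E)
        (CadlagPath.skorokhodJ1Topology E) =
      TopologicalSpace.induced
        (Subtype.val : CadlagPath.jumpControlledPaths k κ x₀ → CadlagPath E)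
        (CadlagPath.localUniformTopology E) := by
  have hJ := CadlagPath.isClosed_skorokhodJ1_jumpControlledPaths (x₀ := x₀) hk hκ_mono hκ_cont
  exact ⟨hJ.mono CadlagPath.localUniformTopology_le_skorokhodJ1Topology, hJ,
    le_antisymm (CadlagPath.induced_skorokhodJ1_le_induced_localUniform hk hκ_mono)
      (induced_mono CadlagPath.localUniformTopology_le_skorokhodJ1Topology)⟩
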